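/- Let $G$ be a finite simple unicyclic graph, that is, a connected graph containing exactly one cycle $C_t$, where $t\ge 3$ is the number of vertices of that cycle. Let $\tau(G)$ be the set of end-vertices (vertices of degree one) of $G$, and suppose that $|\tau(G)|\ge 2$. Then $$|\tau(G)|\;\le\; pd_s(G)\;\le\; |\tau(G)|+2 .$$ Here $pd_s(G)$, the strong partition dimension of $G$, is the minimum number of sets in a strong resolving partition of $G$, i.e. a partition $\Pi$ of $V(G)$ into nonempty sets such that for any two different vertices $x,y$ belonging to the same set of $\Pi$ there is a set $W\in\Pi$ with $x,y\notin W$ and either $d(x,W)=d(x,y)+d(y,W)$ or $d(y,W)=d(y,x)+d(x,W)$, where $d(x,y)$ is the length of a shortest path between $x$ and $y$ and $d(x,W)=\min\{d(x,w): w\in W\}$. -/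

import Mathlib

/-- `G` is unicyclic and its unique cycle has order `t`: `G` is connected, has a cycle of length `t`,
and every cycle of `G` is, as a subgraph (that is, up to the choice of the starting vertex and of the
orientation), this one. -/
def SimpleGraph.IsUnicyclicOfOrder {V : Type*} (G : SimpleGraph V) (t : ℕ) : Prop :=
  G.Connected ∧ ∃ (u : V) (p : G.Walk u u), p.IsCycle ∧ p.length = t ∧
    ∀ (v : V) (q : G.Walk v v), q.IsCycle → q.toSubgraph = p.toSubgraph

/-- A simplicial vertex: its neighbors are pairwise adjacent. -/
def SimpleGraph.IsSimplicialVertex {V : Type*} (G : SimpleGraph V) (v : V) : Prop :=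
  G.IsClique (G.neighborSet v)

/-- The set `τ(G)` of end-vertices, i.e. of simplicial vertices of degree one. -/
def SimpleGraph.endVertices {V : Type*} (G : SimpleGraph V) : Set V :=
  {v | G.IsSimplicialVertex v ∧ (G.neighborSet v).ncard = 1}

/-- The distance `min {d(x, w) : w ∈ W}` from a vertex to a (nonempty) set of vertices. -/
noncomputable def SimpleGraph.distToSet {V : Type*} (G : SimpleGraph V) (x : V) (W : Set V) : ℕ :=
  sInf (G.dist x '' W)

/-- The set `W` strongly resolves the vertices `x, y ∉ W`. -/
def SimpleGraph.SetStronglyResolves {V : Type*} (G : SimpleGraph V) (W : Set V) (x y : V) : Prop :=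
  x ∉ W ∧ y ∉ W ∧
    (G.distToSet x W = G.dist x y + G.distToSet y W ∨
      G.distToSet y W = G.dist y x + G.distToSet x W)

/-- A strong resolving partition: a partition of the vertex set into nonempty sets such that any two
different vertices in the same set are strongly resolved by some set of the partition. -/
def SimpleGraph.IsStrongResolvingPartition {V : Type*} (G : SimpleGraph V)
    (P : Set (Set V)) : Prop :=
  Setoid.IsPartition P ∧
    ∀ U ∈ P, ∀ x ∈ U, ∀ y ∈ U, x ≠ y → ∃ W ∈ P, G.SetStronglyResolves W x y

/-- The strong partition dimension `pd_s(G)` of a finite graph: the minimum cardinality of a strong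
resolving partition. -/
noncomputable def SimpleGraph.strongPartitionDim {V : Type*} [Finite V] (G : SimpleGraph V) : ℕ :=
  sInf {k : ℕ | ∃ P : Set (Set V), G.IsStrongResolvingPartition P ∧ P.ncard = k}

/-- The partition into singletons is strong resolving, so the minimum is over a nonempty set. -/
theorem SimpleGraph.isStrongResolvingPartition_singletons {V : Type*} (G : SimpleGraph V) :
    G.IsStrongResolvingPartition (Set.range fun v : V => ({v} : Set V)) := by
  refine ⟨⟨?_, fun a => ⟨{a}, by simp, ?_⟩⟩, ?_⟩
  · rintro ⟨v, hv⟩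
    exact Set.singleton_ne_empty v hv
  · rintro _ ⟨⟨v, rfl⟩, hv⟩
    rw [Set.mem_singleton_iff.mp hv]
  · rintro _ ⟨v, rfl⟩ x hx y hy hxy
    exact absurd ((Set.mem_singleton_iff.mp hx).trans (Set.mem_singleton_iff.mp hy).symm) hxy

/-- The minimum defining the strong partition dimension is attained. -/
theorem SimpleGraph.exists_ncard_eq_strongPartitionDim {V : Type*} [Finite V]
    (G : SimpleGraph V) :
    ∃ P : Set (Set V), G.IsStrongResolvingPartition P ∧ P.ncard = G.strongPartitionDim :=
  Nat.sInf_mem (s := {k : ℕ | ∃ P : Set (Set V), G.IsStrongResolvingPartition P ∧ P.ncard = k})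
    ⟨_, _, G.isStrongResolvingPartition_singletons, rfl⟩

namespace SimpleGraph

variable {V : Type*} {G : SimpleGraph V}

/-! Lower bound: two end-vertices never share a block, because a geodesic from an end-vertex leaves
through its only neighbor, so no end-vertex lies between two other vertices.

Upper bound: root a breadth-first tree at an end-vertex `u`. Since the cycle is unique, at most one
edge `ab` is outside the tree. The blocks are the singletons of end-vertices, the other ancestors of
`a`, and the rest. Ancestors of one vertex lie on a geodesic from `u`, so `{u}` resolves them. If
`y` is above neither `a` nor `b`, its subtree meets the rest of `G` only through `y` and contains an
end-vertex, which resolves `y` from everything outside. -/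

theorem endVertices_neighborSet {v : V} (hv : v ∈ G.endVertices) :
    ∃ z, G.neighborSet v = {z} :=
  Set.ncard_eq_one.mp hv.2

theorem mem_endVertices_of_neighborSet {v z : V} (h : G.neighborSet v = {z}) :
    v ∈ G.endVertices := by
  refine ⟨?_, ?_⟩
  · unfold IsSimplicialVertex
    rw [h]
    simp
  · rw [h]
    simp

theorem distToSet_singleton (x w : V) : G.distToSet x {w} = G.dist x w := by
  simp [distToSet]

theorem distToSet_le {x w : V} {W : Set V} (hw : w ∈ W) : G.distToSet x W ≤ G.dist x w :=
  Nat.sInf_le ⟨w, hw, rfl⟩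

theorem exists_dist_eq_distToSet (x : V) {W : Set V} (hW : W.Nonempty) :
    ∃ w ∈ W, G.dist x w = G.distToSet x W :=
  Nat.sInf_mem (hW.image (G.dist x))

theorem SetStronglyResolves.symm {W : Set V} {x y : V} (h : G.SetStronglyResolves W x y) :
    G.SetStronglyResolves W y x :=
  ⟨h.2.1, h.1, h.2.2.symm⟩

theorem setStronglyResolves_singleton {w x y : V} (hx : x ≠ w) (hy : y ≠ w)
    (h : G.dist x w = G.dist x y + G.dist y w) : G.SetStronglyResolves {w} x y := by
  refine ⟨hx, hy, Or.inl ?_⟩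
  rwa [distToSet_singleton, distToSet_singleton]

/-- If `z` is the only neighbor of `y`, every other vertex is one step farther from `y` than
from `z`. -/
theorem Connected.dist_eq_add_one_of_neighborSet (hG : G.Connected) {x y z : V}
    (hz : G.neighborSet y = {z}) (hxy : x ≠ y) : G.dist y x = G.dist z x + 1 := by
  have hyz : G.Adj y z := by
    rw [← mem_neighborSet, hz]
    rfl
  obtain ⟨p, hp⟩ := hG.exists_walk_length_eq_dist y x
  cases p with
  | nil => exact absurd rfl hxy
  | @cons _ v _ h q =>
    have hv : v = z := by
      have : v ∈ G.neighborSet y := h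
      rwa [hz] at this
    subst hv
    have h1 := dist_le q
    have h2 := hG.dist_triangle (u := y) (v := v) (w := x)
    rw [dist_eq_one_iff_adj.mpr hyz] at h2
    rw [Walk.length_cons] at hp
    omega

/-- The only neighbor of `y` is one step closer both to `x` and to a nearest `w` in `W`; going
through it saves two steps. -/
theorem Connected.dist_ne_of_mem_endVertices (hG : G.Connected) {x y : V}
    (hy : y ∈ G.endVertices) (hxy : x ≠ y) {W : Set V} (hW : W.Nonempty) (hyW : y ∉ W) :
    G.distToSet x W ≠ G.dist x y + G.distToSet y W := by
  intro h
  obtain ⟨z, hz⟩ := endVertices_neighborSet hy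
  obtain ⟨w, hw, hwd⟩ := exists_dist_eq_distToSet (G := G) y hW
  have hwy : w ≠ y := fun e => hyW (e ▸ hw)
  have h1 := hG.dist_eq_add_one_of_neighborSet hz hxy
  have h2 := hG.dist_eq_add_one_of_neighborSet hz hwy
  have h3 := distToSet_le (G := G) (x := x) hw
  have h4 := hG.dist_triangle (u := x) (v := z) (w := w)
  rw [G.dist_comm (u := x) (v := z)] at h4
  rw [G.dist_comm (u := x) (v := y)] at h
  omega

theorem Connected.ncard_endVertices_le_of_isStrongResolvingPartition [Finite V]
    (hG : G.Connected) {P : Set (Set V)} (hP : G.IsStrongResolvingPartition P) :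
    G.endVertices.ncard ≤ P.ncard := by
  choose f hf using fun v => (hP.1.2 v).exists
  refine Set.ncard_le_ncard_of_injOn f (fun v _ => (hf v).1) ?_ (Set.toFinite P)
  intro x hx y hy hxy
  by_contra hne
  obtain ⟨W, hW, hxW, hyW, h⟩ :=
    hP.2 (f y) (hf y).1 x (hxy ▸ (hf x).2) y (hf y).2 hne
  have hWne : W.Nonempty := Setoid.nonempty_of_mem_partition hP.1 hW
  rcases h with h | h
  · exact hG.dist_ne_of_mem_endVertices hy hne hWne hyW h
  · exact hG.dist_ne_of_mem_endVertices hx (Ne.symm hne) hWne hxW h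

/-- A breadth-first parent map for `G` with root `u`. -/
structure IsParentMap (G : SimpleGraph V) (u : V) (p : V → V) : Prop where
  root : p u = u
  adj : ∀ v, v ≠ u → G.Adj v (p v)
  dist : ∀ v, v ≠ u → G.dist u v = G.dist u (p v) + 1

theorem Connected.exists_isParentMap (hG : G.Connected) (u : V) :
    ∃ p : V → V, G.IsParentMap u p := by
  have key : ∀ v, ∃ w, (v = u → w = u) ∧
      (v ≠ u → G.Adj v w ∧ G.dist u v = G.dist u w + 1) := by
    intro v
    by_cases hv : v = u
    · exact ⟨u, fun _ => rfl, fun h => absurd hv h⟩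
    obtain ⟨q, hq⟩ := hG.exists_walk_length_eq_dist v u
    cases q with
    | nil => exact absurd rfl hv
    | @cons _ w _ h q =>
      refine ⟨w, fun h => absurd h hv, fun _ => ⟨h, ?_⟩⟩
      have h1 := dist_le q
      have h2 := hG.dist_triangle (u := v) (v := w) (w := u)
      rw [dist_eq_one_iff_adj.mpr h] at h2
      rw [Walk.length_cons] at hq
      rw [G.dist_comm (u := u) (v := v), G.dist_comm (u := u) (v := w)]
      omega
  choose p hp using key
  exact ⟨p, (hp u).1 rfl, fun v hv => ((hp v).2 hv).1, fun v hv => ((hp v).2 hv).2⟩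

/-- `w` is an iterated image of `v` under the parent map `p`. -/
def IsAncestor (p : V → V) (w v : V) : Prop :=
  ∃ n : ℕ, p^[n] v = w

theorem IsAncestor.refl (p : V → V) (v : V) : IsAncestor p v v :=
  ⟨0, rfl⟩

theorem IsAncestor.trans {p : V → V} {x y z : V} (h : IsAncestor p x y) (h' : IsAncestor p y z) :
    IsAncestor p x z := by
  obtain ⟨m, rfl⟩ := h
  obtain ⟨n, rfl⟩ := h'
  exact ⟨m + n, Function.iterate_add_apply p m n z⟩

theorem isAncestor_parent (p : V → V) (v : V) : IsAncestor p (p v) v :=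
  ⟨1, rfl⟩

theorem IsAncestor.eq_or_parent {p : V → V} {w v : V} (h : IsAncestor p w v) :
    w = v ∨ IsAncestor p w (p v) := by
  obtain ⟨n, rfl⟩ := h
  cases n with
  | zero => exact Or.inl rfl
  | succ n => exact Or.inr ⟨n, rfl⟩

theorem IsAncestor.total {p : V → V} {x y v : V} (hx : IsAncestor p x v) (hy : IsAncestor p y v) :
    IsAncestor p x y ∨ IsAncestor p y x := by
  obtain ⟨m, rfl⟩ := hx
  obtain ⟨n, rfl⟩ := hy
  rcases le_total m n with h | h
  · exact Or.inr ⟨n - m, by rw [← Function.iterate_add_apply, Nat.sub_add_cancel h]⟩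
  · exact Or.inl ⟨m - n, by rw [← Function.iterate_add_apply, Nat.sub_add_cancel h]⟩

namespace IsParentMap

variable {u : V} {p : V → V}

theorem isAncestor_root (hp : G.IsParentMap u p) (v : V) : IsAncestor p u v := by
  induction hn : G.dist u v using Nat.strong_induction_on generalizing v with
  | _ n ih =>
    by_cases hv : v = u
    · exact hv ▸ IsAncestor.refl p v
    · have h := hp.dist v hv
      exact (ih _ (by omega) (p v) rfl).trans (isAncestor_parent p v)

theorem dist_eq_of_isAncestor (hp : G.IsParentMap u p) (hG : G.Connected) {w v : V}
    (h : IsAncestor p w v) : G.dist u v = G.dist u w + G.dist w v := by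
  obtain ⟨n, hn⟩ := h
  induction n generalizing v with
  | zero =>
    obtain rfl : v = w := hn
    simp
  | succ n ih =>
    have h := ih (v := p v) hn
    by_cases hv : v = u
    · subst hv
      rwa [hp.root] at h
    · have h1 := hp.dist v hv
      have h2 := hG.dist_triangle (u := w) (v := p v) (w := v)
      rw [dist_eq_one_iff_adj.mpr (hp.adj v hv).symm] at h2
      have h3 := hG.dist_triangle (u := u) (v := w) (w := v)
      omega

theorem isAncestor_antisymm (hp : G.IsParentMap u p) (hG : G.Connected) {x y : V}
    (h : IsAncestor p x y) (h' : IsAncestor p y x) : x = y := by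
  have h1 := hp.dist_eq_of_isAncestor hG h
  have h2 := hp.dist_eq_of_isAncestor hG h'
  exact hG.dist_eq_zero_iff.mp (by omega)

theorem setStronglyResolves_root (hp : G.IsParentMap u p) (hG : G.Connected) {x y v : V}
    (hx : IsAncestor p x v) (hy : IsAncestor p y v) (hxu : x ≠ u) (hyu : y ≠ u) :
    G.SetStronglyResolves {u} x y := by
  have key : ∀ {x y : V}, x ≠ u → y ≠ u → IsAncestor p y x → G.SetStronglyResolves {u} x y := by
    intro x y hx hy h
    apply setStronglyResolves_singleton hx hy
    have := hp.dist_eq_of_isAncestor hG h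
    rw [G.dist_comm (u := x) (v := u), G.dist_comm (u := y) (v := u),
      G.dist_comm (u := x) (v := y), this, add_comm]
  rcases hx.total hy with h | h
  · exact (key hyu hxu h).symm
  · exact key hxu hyu h

/-- The breadth-first spanning tree given by a parent map. -/
def _root_.SimpleGraph.parentGraph (p : V → V) : SimpleGraph V :=
  fromRel fun x y => p x = y

theorem parentGraph_le (hp : G.IsParentMap u p) : parentGraph p ≤ G := by
  have key : ∀ x y, x ≠ y → p x = y → G.Adj x y := by
    rintro x _ hxy rfl
    exact hp.adj x fun h => hxy (by rw [h, hp.root])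
  intro x y h
  rw [parentGraph, fromRel_adj] at h
  rcases h.2 with h' | h'
  · exact key x y h.1 h'
  · exact (key y x h.1.symm h').symm

theorem parentGraph_reachable (hp : G.IsParentMap u p) (x y : V) :
    (parentGraph p).Reachable x y := by
  have key : ∀ v, (parentGraph p).Reachable v u := by
    intro v
    obtain ⟨n, hn⟩ := hp.isAncestor_root v
    induction n generalizing v with
    | zero => exact hn ▸ Reachable.refl v
    | succ n ih =>
      refine Reachable.trans ?_ (ih (p v) hn)
      by_cases hv : v = p v
      · exact hv ▸ Reachable.refl v
      · exact Adj.reachable ((fromRel_adj _ _ _).mpr ⟨hv, Or.inl rfl⟩)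
  exact (key x).trans (key y).symm

/-- An edge outside the spanning tree lies on a cycle with no other such edge. -/
theorem exists_isCycle_of_not_adj (hp : G.IsParentMap u p) {a b : V} (hab : G.Adj a b)
    (hn : ¬ (parentGraph p).Adj a b) :
    ∃ q : G.Walk a a, q.IsCycle ∧ s(a, b) ∈ q.edges ∧
      ∀ e ∈ q.edges, e = s(a, b) ∨ e ∈ (parentGraph p).edgeSet := by
  obtain ⟨r, hr⟩ := (hp.parentGraph_reachable b a).exists_isPath
  have hedges : (r.mapLe hp.parentGraph_le).edges = r.edges := by simp
  refine ⟨Walk.cons hab (r.mapLe hp.parentGraph_le), ?_, ?_, ?_⟩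
  · rw [Walk.cons_isCycle_iff]
    refine ⟨hr.mapLe _, fun h => hn ?_⟩
    rw [hedges] at h
    exact r.edges_subset_edgeSet h
  · simp
  · intro e he
    rw [Walk.edges_cons, hedges, List.mem_cons] at he
    exact he.imp_right fun h => r.edges_subset_edgeSet h

/-- Each non-tree edge lies on a cycle containing no other non-tree edge. All cycles have the same
edges, so two non-tree edges coincide. -/
theorem exists_forall_adj (hp : G.IsParentMap u p) {t : ℕ} (hG : G.IsUnicyclicOfOrder t) :
    ∃ a b, ∀ x y, G.Adj x y → (parentGraph p).Adj x y ∨ s(x, y) = s(a, b) := by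
  by_cases h : ∃ a b, G.Adj a b ∧ ¬ (parentGraph p).Adj a b
  · obtain ⟨a, b, hab, hn⟩ := h
    refine ⟨a, b, fun x y hxy => or_iff_not_imp_left.mpr fun hn' => ?_⟩
    obtain ⟨q, hq, -, hq2⟩ := hp.exists_isCycle_of_not_adj hab hn
    obtain ⟨r, hr, hr1, -⟩ := hp.exists_isCycle_of_not_adj hxy hn'
    obtain ⟨-, v, c, -, -, hc⟩ := hG
    have hqr : r.toSubgraph = q.toSubgraph := (hc x r hr).trans (hc a q hq).symm
    rw [← Walk.mem_edges_toSubgraph, hqr, Walk.mem_edges_toSubgraph] at hr1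
    exact (hq2 _ hr1).resolve_right hn'
  · push Not at h
    -- Without a non-tree edge any pair will do.
    exact ⟨u, u, fun x y hxy => Or.inl (h x y hxy)⟩

/-! ### Subtrees containing no end of the extra edge -/

section Descendants

variable {a b y : V} (hp : G.IsParentMap u p) (hG : G.Connected)
  (hab : ∀ x y, G.Adj x y → (parentGraph p).Adj x y ∨ s(x, y) = s(a, b))
  (hya : ¬ IsAncestor p y a) (hyb : ¬ IsAncestor p y b)

include hab hya hyb

theorem parent_eq_or_of_adj {x w : V} (hw : IsAncestor p y w) (h : G.Adj w x) :
    p w = x ∨ p x = w := by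
  rcases hab w x h with h' | h'
  · exact ((fromRel_adj _ _ _).mp h').2
  · rcases Sym2.eq_iff.mp h' with ⟨rfl, rfl⟩ | ⟨rfl, rfl⟩
    · exact absurd hw hya
    · exact absurd hw hyb

include hp in
theorem exists_isAncestor_mem_endVertices [Finite V] :
    ∃ w ∈ G.endVertices, IsAncestor p y w := by
  -- A descendant farthest from the root has no children, so its parent is its only neighbor.
  obtain ⟨w, hw, hmax⟩ := Set.exists_max_image {w | IsAncestor p y w} (G.dist u) (Set.toFinite _)
    ⟨y, IsAncestor.refl p y⟩
  have hwu : w ≠ u := by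
    rintro rfl
    exact hya (IsAncestor.trans hw (hp.isAncestor_root a))
  refine ⟨w, mem_endVertices_of_neighborSet (z := p w) ?_, hw⟩
  ext x
  rw [mem_neighborSet, Set.mem_singleton_iff]
  refine ⟨fun h => ?_, fun h => h ▸ hp.adj w hwu⟩
  rcases parent_eq_or_of_adj hab hya hyb hw h with e | e
  · exact e.symm
  · have hx : IsAncestor p y x := IsAncestor.trans hw (e ▸ isAncestor_parent p x)
    have h1 := hmax x hx
    by_cases hxu : x = u
    · rw [hxu, hp.root] at e
      exact absurd e.symm hwu
    · have h2 := hp.dist x hxu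
      rw [e] at h2
      omega

include hG

/-- A walk from outside can enter the subtree of `y` only at `y`. -/
theorem dist_eq_of_not_isAncestor {x w : V} (hx : ¬ IsAncestor p y x) (hw : IsAncestor p y w) :
    G.dist x w = G.dist x y + G.dist y w := by
  refine le_antisymm hG.dist_triangle ?_
  obtain ⟨q, hq⟩ := hG.exists_walk_length_eq_dist x w
  rw [← hq]
  clear hq
  induction q with
  | nil => exact absurd hw hx
  | @cons x x' w h q ih =>
    have h1 := hG.dist_triangle (u := x) (v := x') (w := y)
    rw [dist_eq_one_iff_adj.mpr h] at h1
    rw [Walk.length_cons]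
    by_cases hx' : IsAncestor p y x'
    · have hyx : y = x' := by
        rcases parent_eq_or_of_adj hab hya hyb hx' h.symm with e | e
        · exact hx'.eq_or_parent.resolve_right (e ▸ hx)
        · exact absurd (hx'.trans (e ▸ isAncestor_parent p x)) hx
      subst hyx
      have h2 := dist_le q
      rw [dist_self] at h1
      omega
    · have := ih hx' hw
      omega

include hp

theorem exists_setStronglyResolves_endVertex [Finite V] {x : V} (hxy : x ≠ y)
    (hx : x ∉ G.endVertices) (hy : y ∉ G.endVertices) :
    ∃ w ∈ G.endVertices, G.SetStronglyResolves {w} x y := by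
  by_cases hyx : IsAncestor p y x
  -- If `x` is below `y`, its subtree also avoids `a` and `b`, and `y` is outside it, so the roles
  -- swap.
  · have hxa : ¬ IsAncestor p x a := fun h => hya (hyx.trans h)
    have hxb : ¬ IsAncestor p x b := fun h => hyb (hyx.trans h)
    have hxy' : ¬ IsAncestor p x y := fun h => hxy (hp.isAncestor_antisymm hG h hyx)
    obtain ⟨w, hw, hxw⟩ := hp.exists_isAncestor_mem_endVertices hab hxa hxb
    exact ⟨w, hw, (setStronglyResolves_singleton (ne_of_mem_of_not_mem hw hy).symm
      (ne_of_mem_of_not_mem hw hx).symm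
      (dist_eq_of_not_isAncestor hG hab hxa hxb hxy' hxw)).symm⟩
  · obtain ⟨w, hw, hyw⟩ := hp.exists_isAncestor_mem_endVertices hab hya hyb
    exact ⟨w, hw, setStronglyResolves_singleton (ne_of_mem_of_not_mem hw hx).symm
      (ne_of_mem_of_not_mem hw hy).symm
      (dist_eq_of_not_isAncestor hG hab hya hyb hyx hyw)⟩

end Descendants

end IsParentMap

/-- The partition of `V` into the singletons of `S` and the nonempty ones among `A \ S`, `Aᶜ \ S`. -/
def singletonPartition (S A : Set V) : Set (Set V) :=
  ((fun v => {v}) '' S ∪ {A \ S, Aᶜ \ S}) \ {∅}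

theorem isPartition_singletonPartition (S A : Set V) :
    Setoid.IsPartition (singletonPartition S A) := by
  refine ⟨fun h => h.2 rfl, fun x => ?_⟩
  by_cases hx : x ∈ S
  · refine ⟨{x}, ⟨⟨Or.inl ⟨x, hx, rfl⟩, Set.singleton_ne_empty x⟩, rfl⟩, ?_⟩
    rintro U ⟨⟨⟨v, -, rfl⟩ | rfl | rfl, -⟩, hxU⟩
    · rw [Set.mem_singleton_iff.mp hxU]
    · exact absurd hx hxU.2
    · exact absurd hx hxU.2
  · by_cases hA : x ∈ A
    · refine ⟨A \ S, ⟨⟨Or.inr (Or.inl rfl), fun h => ?_⟩, hA, hx⟩, ?_⟩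
      · exact (h ▸ (⟨hA, hx⟩ : x ∈ A \ S) : x ∈ (∅ : Set V))
      rintro U ⟨⟨⟨v, hv, rfl⟩ | rfl | rfl, -⟩, hxU⟩
      · exact absurd (Set.mem_singleton_iff.mp hxU ▸ hv) hx
      · rfl
      · exact absurd hA hxU.1
    · refine ⟨Aᶜ \ S, ⟨⟨Or.inr (Or.inr rfl), fun h => ?_⟩, hA, hx⟩, ?_⟩
      · exact (h ▸ (⟨hA, hx⟩ : x ∈ Aᶜ \ S) : x ∈ (∅ : Set V))
      rintro U ⟨⟨⟨v, hv, rfl⟩ | rfl | rfl, -⟩, hxU⟩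
      · exact absurd (Set.mem_singleton_iff.mp hxU ▸ hv) hx
      · exact absurd hxU.1 hA
      · rfl

theorem ncard_singletonPartition_le [Finite V] (S A : Set V) :
    (singletonPartition S A).ncard ≤ S.ncard + 2 := by
  refine (Set.ncard_le_ncard Set.sdiff_subset (Set.toFinite _)).trans ?_
  refine (Set.ncard_union_le _ _).trans (add_le_add (Set.ncard_image_le (Set.toFinite S)) ?_)
  exact (Set.ncard_insert_le _ _).trans (by rw [Set.ncard_singleton])

theorem IsUnicyclicOfOrder.exists_isStrongResolvingPartition [Finite V] {t : ℕ}
    (hG : G.IsUnicyclicOfOrder t) (hτ : G.endVertices.Nonempty) :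
    ∃ P, G.IsStrongResolvingPartition P ∧ P.ncard ≤ G.endVertices.ncard + 2 := by
  obtain ⟨u, hu⟩ := hτ
  have hc : G.Connected := hG.1
  obtain ⟨p, hp⟩ := hc.exists_isParentMap u
  obtain ⟨a, b, hab⟩ := hp.exists_forall_adj hG
  have hmem : ∀ w ∈ G.endVertices,
      {w} ∈ singletonPartition G.endVertices {x | IsAncestor p x a} :=
    fun w hw => ⟨Or.inl ⟨w, hw, rfl⟩, Set.singleton_ne_empty w⟩
  have hne : ∀ {x}, x ∉ G.endVertices → x ≠ u := fun hx e => hx (e ▸ hu)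
  refine ⟨singletonPartition G.endVertices {x | IsAncestor p x a},
    ⟨isPartition_singletonPartition _ _, ?_⟩, ncard_singletonPartition_le _ _⟩
  rintro U ⟨⟨v, -, rfl⟩ | rfl | rfl, -⟩ x hx y hy hxy
  · exact absurd (hx.trans (Eq.symm hy)) hxy
  · exact ⟨{u}, hmem u hu, hp.setStronglyResolves_root hc hx.1 hy.1 (hne hx.2) (hne hy.2)⟩
  -- Nothing in this block is above `a`: either both vertices are above `b`, or one is above neither
  -- end.
  · by_cases hyb : IsAncestor p y b
    · by_cases hxb : IsAncestor p x b
      · exact ⟨{u}, hmem u hu, hp.setStronglyResolves_root hc hxb hyb (hne hx.2) (hne hy.2)⟩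
      · obtain ⟨w, hw, h⟩ :=
          hp.exists_setStronglyResolves_endVertex hc hab hx.1 hxb hxy.symm hy.2 hx.2
        exact ⟨{w}, hmem w hw, h.symm⟩
    · obtain ⟨w, hw, h⟩ :=
        hp.exists_setStronglyResolves_endVertex hc hab hy.1 hyb hxy hx.2 hy.2
      exact ⟨{w}, hmem w hw, h⟩

end SimpleGraph

theorem mainTheorem3 {V : Type*} [Finite V] (G : SimpleGraph V) (t : ℕ) (ht : 3 ≤ t)
    (hG : G.IsUnicyclicOfOrder t) (hτ : 2 ≤ G.endVertices.ncard) :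
    G.endVertices.ncard ≤ G.strongPartitionDim ∧
      G.strongPartitionDim ≤ G.endVertices.ncard + 2 := by
  constructor
  · obtain ⟨P, hP, hcard⟩ := G.exists_ncard_eq_strongPartitionDim
    exact hcard ▸ hG.1.ncard_endVertices_le_of_isStrongResolvingPartition hP
  · have hne : G.endVertices.Nonempty := Set.nonempty_of_ncard_ne_zero (by omega)
    obtain ⟨P, hP, hcard⟩ := hG.exists_isStrongResolvingPartition hne
    exact (Nat.sInf_le ⟨P, hP, rfl⟩ : G.strongPartitionDim ≤ P.ncard).trans hcard
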